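/- Let $S$ be any set of states and let $W:\{0,1\}\times S\to\{0,1\}$ be any binary (discrete memoryless) arbitrarily varying channel, i.e. a family of stochastic matrices $W(y\mid x,s)$, $s\in S$. For $\mathbf s\in S^n$ and $\mathbf x\in\{0,1\}^n$ let $W_{\mathbf s}(\mathbf x)$ be the random string that equals $\mathbf y\in\{0,1\}^n$ with probability $\prod_{t=1}^n W(y_t\mid x_t,s_t)$. A $(k,n)$-coding scheme is a pair of a randomized encoder $\mathsf{Enc}:\{0,1\}^k\to\{0,1\}^n$ and a deterministic decoder $\mathsf{Dec}:\{0,1\}^n\to\{0,1\}^k\cup\{\bot\}$ with $\Pr[\mathsf{Dec}(\mathsf{Enc}(\mathbf m))=\mathbf m]=1$ for every $\mathbf m\in\{0,1\}^k$; its rate is $k/n$. It is $\varepsilon$-non-malleable for $W$ if for every state sequence $\mathbf s\in S^n$ there is a probability distribution $\mathcal D_{\mathbf s}$ on $\{0,1\}^k\cup\{\bot,\mathsf{same}^*\}$ such that, for every message $\mathbf m\in\{0,1\}^k$, the statistical distance (total variation distance) between $\mathsf{Dec}(W_{\mathbf s}(\mathsf{Enc}(\mathbf m)))$ and $\mathsf{Copy}(\mathcal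 D_{\mathbf s},\mathbf m)$ is at most $\varepsilon$; here $\mathsf{Copy}(\mathcal D,\mathbf m)$ is the output of sampling from $\mathcal D$ and replacing the symbol $\mathsf{same}^*$ by $\mathbf m$. Then there exist non-malleable coding schemes for $W$ achieving rate $1$: there are integers $k_n\ge 0$, reals $\varepsilon_n$, and for every $n$ a $(k_n,n)$-coding scheme that is $\varepsilon_n$-non-malleable for $W$, such that $k_n/n\to 1$ as $n\to\infty$ and $\varepsilon_n$ is negligible, i.e. $n^{c}\varepsilon_n\to 0$ for every $c\in\mathbb N$. -/

import Mathlib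

open Filter Topology

noncomputable section

namespace NonMalleableAVC

/-- The binary strings `{0,1}^n`. -/
abbrev BitStr (n : ℕ) : Type := Fin n → Bool

/-- A discrete memoryless arbitrarily varying channel `W : X × S → Y`: a family of stochastic
matrices, where `W x s` is the distribution `W(· | x, s)` of the output symbol. -/
abbrev AVC (X S Y : Type*) := X → S → PMF Y

/-- The distribution `W_s(x)` of the output sequence for the input sequence `x` and the state
sequence `s`: it gives `y` the probability `∏ t, W(y_t | x_t, s_t)`. -/
def AVC.seqOutput {X S Y : Type*} [Fintype Y] (W : AVC X S Y) {n : ℕ}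
    (s : Fin n → S) (x : Fin n → X) : PMF (Fin n → Y) :=
  PMF.ofFintype (fun y => ∏ t, W (x t) (s t) (y t)) (by
    classical
    have h : ∀ t, ∑ b, W (x t) (s t) b = 1 := fun t => by
      simpa [tsum_fintype] using PMF.tsum_coe (W (x t) (s t))
    rw [← Fintype.prod_sum (fun t b => W (x t) (s t) b)]
    simp [h])

/-- Statistical (total variation) distance of two distributions on a finite set. -/
def statDist {Ω : Type*} [Fintype Ω] (P Q : PMF Ω) : ℝ :=
  (1 / 2) * ∑ ω, |(P ω).toReal - (Q ω).toReal|

/-- A `(k,n)`-coding scheme: a randomized encoder and a deterministic decoder, whose output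
`none` is the symbol `⊥`, with `Pr[Dec(Enc(m)) = m] = 1` for every message `m`. -/
structure CodingScheme (k n : ℕ) where
  enc : BitStr k → PMF (BitStr n)
  dec : BitStr n → Option (BitStr k)
  correct : ∀ m, ((enc m).map dec) (some m) = 1

/-- The tampering experiment: encode `m`, send the codeword through the channel with state
sequence `s`, decode. -/
def tamper {S : Type*} {k n : ℕ} (C : CodingScheme k n) (W : AVC Bool S Bool)
    (s : Fin n → S) (m : BitStr k) : PMF (Option (BitStr k)) :=
  ((C.enc m).bind (fun x => W.seqOutput s x)).map C.dec

/-- `Copy(D, m)`: sample from `D` and replace the symbol `same*` by `m`. A distribution over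
`{0,1}^k ∪ {⊥, same*}` is a `PMF` on `Option (Option (BitStr k))`: `none` is `same*`,
`some none` is `⊥`, and `some (some m')` is the message `m'`. -/
def copy {k : ℕ} (D : PMF (Option (Option (BitStr k)))) (m : BitStr k) :
    PMF (Option (BitStr k)) :=
  D.map (fun d => d.getD (some m))

/-- The scheme is `ε`-non-malleable for the AVC: for every state sequence there is a
distribution, independent of the message, that simulates the tampering experiment up to
statistical distance `ε`. -/
def IsNonMalleable {S : Type*} {k n : ℕ} (C : CodingScheme k n) (W : AVC Bool S Bool)
    (ε : ℝ) : Prop :=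
  ∀ s : Fin n → S, ∃ D : PMF (Option (Option (BitStr k))),
    ∀ m : BitStr k, statDist (tamper C W s m) (copy D m) ≤ ε

end NonMalleableAVC

end

noncomputable section

namespace NonMalleableAVC

/-! ### Exponential moments and tail bounds for uniformly random functions -/

/-! The proof rests on a random code and two observations. For a fixed state sequence, evaluating
the channel independently at every position and on both possible input bits gives a random map `Fin
n → Bool → Bool`. Its law does not depend on the codeword, so the channel is a mixture of bitwise
tampering functions. Since statistical distance is convex, it suffices to handle each of the `4 ^ n`
bitwise functions separately (`isNonMalleable_of_bitwise`).

Label every string of length `n` by a random pair in `BitStr k × Fin d`. The codewords of `m` are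
the strings labelled `(m, 0)`, and a string with nonzero second label decodes to `⊥`. For a bitwise
`F` there are two cases (`IsPseudorandom.exists_simulator`). If `F` has a large image, a tampered
codeword that differs from the original almost always lands on a label with nonzero second
component. The outcome is then `same*` on the fixed points of `F` and `⊥` elsewhere. The fixed
points form a subcube, so their frequency hardly depends on the message. If `F` has a small image,
its fibres are few and are subcubes or empty. The codewords of each message are equidistributed over
subcubes, so the tampered codeword is distributed almost like the image of a uniform string.

Both properties fail for a random labelling with probability doubly exponentially small in `√n`,
which beats a union bound over `2 ^ O(n)` events (`card_tail_le`, `exists_isPseudorandom`). The loss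
`n - k = 11 √n` leaves the rate tending to 1. -/

theorem sum_exp_indicator_le {A : Type*} [Fintype A] [Nonempty A] (S : Finset A)
    [DecidablePred (· ∈ S)] {w : ℝ} (hw : |w| ≤ 1) :
    ∑ a : A, Real.exp (if a ∈ S then w else 0) ≤
      Fintype.card A * Real.exp ((S.card / Fintype.card A : ℝ) * (w + w ^ 2)) := by
  have hA : (0 : ℝ) < Fintype.card A := by exact_mod_cast Fintype.card_pos
  have h1 : ∑ a : A, Real.exp (if a ∈ S then w else 0) =
      Fintype.card A + S.card * (Real.exp w - 1) := by
    have : ∀ a : A, Real.exp (if a ∈ S then w else 0) =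
        1 + if a ∈ S then (Real.exp w - 1) else 0 := by
      intro a; split_ifs <;> simp
    simp only [this, Finset.sum_add_distrib]
    simp [mul_sub]
  have h2 : Real.exp w - 1 ≤ w + w ^ 2 := by
    have := (abs_le.mp (Real.abs_exp_sub_one_sub_id_le hw)).2
    linarith
  rw [h1]
  calc (Fintype.card A : ℝ) + S.card * (Real.exp w - 1)
      ≤ Fintype.card A + S.card * (w + w ^ 2) := by gcongr
    _ = Fintype.card A * ((S.card / Fintype.card A : ℝ) * (w + w ^ 2) + 1) := by
        field_simp; ring
    _ ≤ _ := by gcongr; exact Real.add_one_le_exp _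

theorem sum_exp_fun_le {X A : Type*} [Fintype X] [DecidableEq X] [Fintype A] [Nonempty A]
    (S : Finset A) [DecidablePred (· ∈ S)] {w : X → ℝ} (hw : ∀ x, |w x| ≤ 1) :
    ∑ D : X → A, Real.exp (∑ x, if D x ∈ S then w x else 0) ≤
      (Fintype.card A : ℝ) ^ Fintype.card X *
        Real.exp ((S.card / Fintype.card A : ℝ) * ∑ x, (w x + w x ^ 2)) := by
  simp only [Real.exp_sum]
  rw [← Fintype.prod_sum (fun x a => Real.exp (if a ∈ S then w x else 0))]
  refine (Finset.prod_le_prod (fun x _ => Finset.sum_nonneg fun _ _ => (Real.exp_pos _).le)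
    (fun x _ => sum_exp_indicator_le S (hw x))).trans (le_of_eq ?_)
  rw [Finset.prod_mul_distrib, ← Real.exp_sum, Finset.mul_sum]
  simp

/-- Chernoff bound for a random function `D`, where the weights `w D` vanish off `H` and depend
only on the values of `D` off `H`. -/
theorem card_tail_le {X A : Type*} [Fintype X] [DecidableEq X] [Fintype A] [Nonempty A]
    (S : Finset A) [DecidablePred (· ∈ S)] (H : X → Prop) [DecidablePred H]
    {w : (X → A) → X → ℝ} (hw : ∀ D x, |w D x| ≤ 1)
    (hdep : ∀ D D' : X → A, (∀ x, ¬ H x → D x = D' x) → w D = w D')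
    (hsupp : ∀ D x, ¬ H x → w D x = 0) {B r : ℝ}
    (hB : ∀ D, (S.card / Fintype.card A : ℝ) * ∑ x, (w D x + w D x ^ 2) ≤ B)
    (P : (X → A) → Prop) [DecidablePred P]
    (hP : ∀ D, P D → r ≤ ∑ x, if D x ∈ S then w D x else 0) :
    ((Finset.univ.filter P).card : ℝ) ≤ Fintype.card (X → A) * Real.exp (B - r) := by
  have hsplit : ∀ f : X → ℝ, (∀ x, ¬ H x → f x = 0) → ∑ x, f x = ∑ x : {x // H x}, f x := by
    intro f hf
    rw [← Fintype.sum_subtype_add_sum_subtype H f,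
      Finset.sum_eq_zero (s := (Finset.univ : Finset {x // ¬ H x})) (fun x _ => hf x x.2), add_zero]
  have hcard : ((Finset.univ.filter P).card : ℝ) * Real.exp r ≤
      ∑ D : X → A, Real.exp (∑ x, if D x ∈ S then w D x else 0) := by
    rw [← nsmul_eq_mul]
    refine (Finset.card_nsmul_le_sum (Finset.univ.filter P) _ _ fun D hD => ?_).trans
      (Finset.sum_le_sum_of_subset_of_nonneg (Finset.filter_subset _ _)
        fun _ _ _ => (Real.exp_pos _).le)
    exact Real.exp_le_exp.mpr (hP D (Finset.mem_filter.mp hD).2)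
  have hmgf : ∑ D : X → A, Real.exp (∑ x, if D x ∈ S then w D x else 0) ≤
      Fintype.card (X → A) * Real.exp B := by
    -- Condition on the values `D₂` of `D` off `H`. This freezes the weights, and the values on `H`
    -- remain independent and uniform.
    let e := Equiv.piEquivPiSubtypeProd H (fun _ : X => A)
    rw [← e.symm.sum_comp, Fintype.sum_prod_type_right, Fintype.card_congr e, Fintype.card_prod,
      Nat.cast_mul, mul_comm (Fintype.card ({x // H x} → A) : ℝ), mul_assoc, ← nsmul_eq_mul]
    refine Finset.sum_le_card_nsmul _ _ _ fun D₂ _ => ?_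
    have hin : ∀ (D₁ : {x // H x} → A) (x : {x // H x}), e.symm (D₁, D₂) x = D₁ x := by
      intro D₁ x
      simp [e, Equiv.piEquivPiSubtypeProd, x.2]
    obtain ⟨a⟩ := ‹Nonempty A›
    set v : X → ℝ := w (e.symm (fun _ => a, D₂)) with hv
    have hconst : ∀ D₁, w (e.symm (D₁, D₂)) = v := by
      intro D₁
      refine hdep _ _ fun x hx => ?_
      simp [e, Equiv.piEquivPiSubtypeProd, hx]
    have : Nonempty A := ⟨a⟩
    have := sum_exp_fun_le S (w := fun x : {x // H x} => v x) (fun x => hw _ _)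
    refine (Eq.trans_le ?_ this).trans ?_
    · refine Finset.sum_congr rfl fun D₁ _ => ?_
      rw [hsplit]
      · simp only [hconst, hin]
      · intro x hx
        simp [hsupp _ x hx]
    · rw [← hsplit (fun x => v x + v x ^ 2) (fun x hx => by simp [hv, hsupp _ x hx])]
      simp only [Fintype.card_fun, Nat.cast_pow]
      gcongr
      exact hB _
  rw [Real.exp_sub, ← mul_div_assoc, le_div_iff₀ (Real.exp_pos r)]
  exact hcard.trans hmgf

/-! ### Three tail bounds for a random labelling -/

section RandomFunction

variable {X A : Type*} [Fintype X] [DecidableEq X] [Fintype A] [DecidableEq A] [Nonempty A]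

-- The sign `c` covers both tails. Weight `c * (η / 2)` on `Q` makes the exponent at most `N η² / 4
-- - N η² / 2`, where `N` is the mean fibre size `|X| / |A|`.
open Classical in
theorem card_signed_deviation_le (Q : Finset X) (a : A) {η : ℝ} (h0 : 0 ≤ η) (h1 : η ≤ 1)
    {c : ℝ} (hc : |c| = 1) :
    ((Finset.univ.filter fun D : X → A => (Fintype.card X / Fintype.card A : ℝ) * η ≤
      c * (((Q.filter fun x => D x = a).card : ℝ) - Q.card / Fintype.card A)).card : ℝ) ≤
      Fintype.card (X → A) * Real.exp (-((Fintype.card X / Fintype.card A : ℝ) * η ^ 2 / 4)) := by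
  have hA : (0 : ℝ) < Fintype.card A := by exact_mod_cast Fintype.card_pos
  have hQ : (Q.card : ℝ) ≤ Fintype.card X := by exact_mod_cast Finset.card_le_univ Q
  have hc2 : c ^ 2 = 1 := by rw [← sq_abs, hc]; norm_num
  have hsum : ∀ z : ℝ, ∑ x : X, (if x ∈ Q then z else 0) = Q.card * z := by
    intro z; simp
  refine (card_tail_le {a} (fun _ => True)
    (w := fun _ x => if x ∈ Q then c * (η / 2) else 0)
    (B := (c * (η / 2) + (η / 2) ^ 2) * (Q.card / Fintype.card A))
    (r := c * (η / 2) * (Q.card / Fintype.card A) +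
      η / 2 * ((Fintype.card X / Fintype.card A : ℝ) * η)) ?_ ?_ ?_ ?_ _ ?_).trans ?_
  · intro _ x
    split_ifs
    · rw [abs_mul, hc, abs_of_nonneg (by positivity)]; linarith
    · simp
  · intros; rfl
  · simp
  · intro _
    have : ∀ x, (if x ∈ Q then c * (η / 2) else 0) + (if x ∈ Q then c * (η / 2) else 0) ^ 2 =
        if x ∈ Q then c * (η / 2) + (c * (η / 2)) ^ 2 else 0 := by
      intro x; split_ifs <;> simp
    simp only [this, hsum, Finset.card_singleton, Nat.cast_one, mul_pow, hc2, one_mul]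
    apply le_of_eq; field_simp
  · intro D hD
    have : (∑ x, if D x ∈ ({a} : Finset A) then (if x ∈ Q then c * (η / 2) else 0) else 0) =
        (Q.filter fun x => D x = a).card * (c * (η / 2)) := by
      rw [← nsmul_eq_mul, ← Finset.sum_const, Finset.sum_filter]
      simp only [Finset.mem_singleton, ← ite_and, and_comm (a := D _ = a)]
      simp only [ite_and, Finset.sum_ite_mem, Finset.univ_inter]
    rw [this]
    have := mul_le_mul_of_nonneg_left hD (by positivity : 0 ≤ η / 2)
    linarith
  · gcongr
    have : (Q.card / Fintype.card A : ℝ) ≤ Fintype.card X / Fintype.card A := by gcongr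
    nlinarith [sq_nonneg η]

/-- Concentration of the number of points of `Q` that a random function maps to `a`. -/
theorem card_deviation_le (Q : Finset X) (a : A) {η : ℝ} (h0 : 0 ≤ η) (h1 : η ≤ 1)
    (P : (X → A) → Prop) [DecidablePred P]
    (hP : ∀ D, P D → (Fintype.card X / Fintype.card A : ℝ) * η <
      |((Q.filter fun x => D x = a).card : ℝ) - Q.card / Fintype.card A|) :
    ((Finset.univ.filter P).card : ℝ) ≤ 2 * (Fintype.card (X → A) *
      Real.exp (-((Fintype.card X / Fintype.card A : ℝ) * η ^ 2 / 4))) := by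
  classical
  have hp := card_signed_deviation_le Q a h0 h1 (c := 1) (by simp)
  have hm := card_signed_deviation_le Q a h0 h1 (c := -1) (by simp)
  rw [two_mul]
  refine le_trans ?_ (add_le_add hp hm)
  norm_cast
  refine (Finset.card_le_card ?_).trans (Finset.card_union_le _ _)
  intro D hD
  have := hP D (Finset.mem_filter.mp hD).2
  simp only [Finset.mem_union, Finset.mem_filter, Finset.mem_univ, true_and]
  rcases lt_abs.mp this with h | h
  · left; linarith
  · right; push_cast; linarith

/-- If `f` has small fibres, then a random function rarely maps much of the image measure of `f`
into a small set `S`. -/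
theorem card_preimage_large_le (f : X → X) (S : Finset A) {L ε : ℝ} (hL : 0 ≤ L)
    [Nonempty X]
    (hf : ∀ y, ((Finset.univ.filter fun x => f x = y).card : ℝ) * L ≤ Fintype.card X)
    (P : (X → A) → Prop) [DecidablePred P]
    (hP : ∀ D, P D → ε * Fintype.card X ≤ (Finset.univ.filter fun x => D (f x) ∈ S).card) :
    ((Finset.univ.filter P).card : ℝ) ≤ Fintype.card (X → A) *
      Real.exp ((S.card / Fintype.card A : ℝ) * (2 * L) - ε * L) := by
  have hX : (0 : ℝ) < Fintype.card X := by exact_mod_cast Fintype.card_pos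
  -- The image measure of `f`, scaled to total mass `L`. The fibre bound is exactly what keeps each
  -- weight at most 1.
  set w : X → ℝ := fun y => (Finset.univ.filter fun x => f x = y).card * L / Fintype.card X
    with hw
  have hw0 : ∀ y, 0 ≤ w y := fun y => by positivity
  have hw1 : ∀ y, w y ≤ 1 := fun y => (div_le_one hX).mpr (hf y)
  have hsum : ∀ T : Finset X, ∑ y ∈ T, w y =
      (Finset.univ.filter fun x => f x ∈ T).card * (L / Fintype.card X) := by
    intro T
    rw [Finset.card_eq_sum_card_fiberwise (f := f) (t := T) (fun x hx => by simpa using hx)]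
    push_cast
    rw [Finset.sum_mul]
    refine Finset.sum_congr rfl fun y hy => ?_
    simp only [hw]
    rw [mul_div_assoc, Finset.filter_filter]
    congr 3
    ext x
    simp only [Finset.mem_filter, Finset.mem_univ, true_and]
    exact ⟨fun h => ⟨h ▸ hy, h⟩, fun h => h.2⟩
  refine card_tail_le S (fun _ => True) (w := fun _ => w) ?_ ?_ ?_ ?_ P ?_
  · intro _ y
    rw [abs_of_nonneg (hw0 y)]; exact hw1 y
  · intros; rfl
  · simp
  · intro _
    gcongr
    have h2 : ∑ y, w y = L := by
      rw [hsum]; simp; field_simp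
    calc ∑ y, (w y + w y ^ 2) ≤ ∑ y, 2 * w y := by
          gcongr with y; nlinarith [hw0 y, hw1 y]
      _ = 2 * L := by rw [← Finset.mul_sum, h2]
  · intro D hD
    have := hsum (Finset.univ.filter fun y => D y ∈ S)
    rw [Finset.sum_filter] at this
    rw [this]
    simp only [Finset.mem_filter, Finset.mem_univ, true_and]
    calc ε * L = ε * Fintype.card X * (L / Fintype.card X) := by field_simp
      _ ≤ _ := by gcongr; exact hP D hD

/-- Points of `H` that `f` moves out of `H` into the preimage of `S` are rarely numerous in a
single fibre of a random function. -/
theorem card_moved_large_le (f : X → X) (H : X → Prop) [DecidablePred H] (S : Finset A) (a : A)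
    {τ r : ℝ} (hτ : 0 ≤ τ) (P : (X → A) → Prop) [DecidablePred P]
    (hP : ∀ D, P D → ((Finset.univ.filter fun x => D (f x) ∈ S).card : ℝ) ≤ τ ∧
      r ≤ (Finset.univ.filter fun x => (H x ∧ ¬ H (f x) ∧ D (f x) ∈ S) ∧ D x = a).card) :
    ((Finset.univ.filter P).card : ℝ) ≤ Fintype.card (X → A) *
      Real.exp (2 * τ / Fintype.card A - r) := by
  classical
  set T : (X → A) → Finset X := fun D =>
    Finset.univ.filter fun x => H x ∧ ¬ H (f x) ∧ D (f x) ∈ S with hT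
  -- Membership in `T D` looks at `D` only at points `f x` off `H`, so the weights are independent
  -- of the labels on `H`. Truncating at `τ` makes the exponent bound hold for every `D`.
  refine card_tail_le {a} H
    (w := fun D x => if x ∈ T D ∧ ((T D).card : ℝ) ≤ τ then 1 else 0) ?_ ?_ ?_ ?_ P ?_
  · intro D x; split_ifs <;> simp
  · intro D D' h
    have : T D = T D' := by
      ext x
      simp only [hT, Finset.mem_filter, Finset.mem_univ, true_and]
      refine and_congr_right fun _ => and_congr_right fun hx => ?_
      rw [h _ hx]
    simp only [this]
  · intro D x hx
    rw [if_neg]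
    simp [hT, hx]
  · intro D
    rw [Finset.card_singleton, Nat.cast_one, one_div, mul_comm, div_eq_mul_inv]
    gcongr
    have : ∀ x, (if x ∈ T D ∧ ((T D).card : ℝ) ≤ τ then (1 : ℝ) else 0) +
        (if x ∈ T D ∧ ((T D).card : ℝ) ≤ τ then (1 : ℝ) else 0) ^ 2 =
        if x ∈ T D then (if ((T D).card : ℝ) ≤ τ then 2 else 0) else 0 := by
      intro x
      by_cases h1 : x ∈ T D <;> by_cases h2 : ((T D).card : ℝ) ≤ τ <;> (simp [h1, h2]; try norm_num)
    simp only [this, Finset.sum_ite_mem, Finset.univ_inter, Finset.sum_const, nsmul_eq_mul]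
    split_ifs <;> linarith
  · intro D hD
    obtain ⟨h1, h2⟩ := hP D hD
    have hle : ((T D).card : ℝ) ≤ τ := by
      refine le_trans ?_ h1
      norm_cast
      refine Finset.card_le_card fun x hx => ?_
      simp only [hT, Finset.mem_filter, Finset.mem_univ, true_and] at hx ⊢
      exact hx.2.2
    refine h2.trans (le_of_eq ?_)
    rw [Finset.card_filter]
    push_cast
    refine Finset.sum_congr rfl fun x _ => ?_
    have hx : (H x ∧ ¬ H (f x) ∧ D (f x) ∈ S) ↔ x ∈ T D := by simp [hT]
    by_cases h3 : x ∈ T D <;> by_cases h4 : D x = a <;> simp [hx, h3, h4, hle]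

end RandomFunction

/-! ### Bitwise tampering -/

/-- The bitwise tampering function that applies `F t` to the `t`-th bit. -/
def bitwise {n : ℕ} (F : Fin n → Bool → Bool) (x : BitStr n) : BitStr n := fun t => F t (x t)

/-- The subcube of strings all of whose bits are accepted by `G`. -/
def cube {n : ℕ} (G : Fin n → Bool → Bool) : Finset (BitStr n) :=
  Finset.univ.filter fun x => ∀ t, G t (x t) = true

/-- The size of the image of a bitwise tampering function. -/
def spread {n : ℕ} (F : Fin n → Bool → Bool) : ℕ := ∏ t, (Finset.univ.image (F t)).card

/-- Both factors are products over coordinates. A map of `Bool` is either constant or injective, so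
fibre size times image size is at most 2 in each coordinate. -/
theorem card_fiber_mul_spread_le {n : ℕ} (F : Fin n → Bool → Bool) (y : BitStr n) :
    (Finset.univ.filter fun x => bitwise F x = y).card * spread F ≤ 2 ^ n := by
  have h : (Finset.univ.filter fun x => bitwise F x = y) =
      Fintype.piFinset fun t => Finset.univ.filter fun b => F t b = y t := by
    ext x; simp [bitwise, funext_iff]
  rw [h, Fintype.card_piFinset, spread, ← Finset.prod_mul_distrib]
  refine (Finset.prod_le_pow_card _ _ 2 fun t _ => ?_).trans (by simp)
  generalize F t = g, y t = b
  revert g b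
  decide

theorem card_image_bitwise_le {n : ℕ} (F : Fin n → Bool → Bool) :
    (Finset.univ.image (bitwise F)).card ≤ spread F := by
  rw [spread, ← Fintype.card_piFinset]
  refine Finset.card_le_card fun y hy => ?_
  obtain ⟨x, -, rfl⟩ := Finset.mem_image.mp hy
  exact Fintype.mem_piFinset.mpr fun t => Finset.mem_image_of_mem _ (Finset.mem_univ (x t))

/-- The labelling `D` distributes every message evenly over all subcubes, and a bitwise tampering
function with large image seldom maps a codeword to a different codeword. Codewords of `m` are the
strings labelled `(m, 0)`. -/
structure IsPseudorandom {n k d : ℕ} [NeZero d] (D : BitStr n → BitStr k × Fin d)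
    (L η ε : ℝ) : Prop where
  balanced : ∀ (G : Fin n → Bool → Bool) (m : BitStr k),
    |(((cube G).filter fun x => D x = (m, 0)).card : ℝ) - (cube G).card / (2 ^ k * d)| ≤
      2 ^ n / (2 ^ k * d) * η
  -- The factor `2 * n` counts pairs of a coordinate and a bit. `3 * ε * (2 ^ n / (2 ^ k * d))` is
  -- the threshold for one such pair.
  sparse : ∀ F : Fin n → Bool → Bool, L ≤ spread F → ∀ m : BitStr k,
    ((Finset.univ.filter fun x => D x = (m, 0) ∧ bitwise F x ≠ x ∧
      (D (bitwise F x)).2 = 0).card : ℝ) ≤ 2 * n * (3 * ε * (2 ^ n / (2 ^ k * d)))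

/-! ### Existence of a pseudorandom labelling -/

open Classical in
theorem exists_forall_not_of_card_lt {Ω ι : Type*} [Fintype Ω] [Nonempty Ω] [Fintype ι]
    (bad : ι → Ω → Prop) {β : ℝ}
    (h : ∀ i, ((Finset.univ.filter (bad i)).card : ℝ) ≤ β * Fintype.card Ω)
    (hβ : Fintype.card ι * β < 1) : ∃ ω, ∀ i, ¬ bad i ω := by
  by_contra! hcon
  have hΩ : (0 : ℝ) < Fintype.card Ω := by exact_mod_cast Fintype.card_pos
  have h1 : (Fintype.card Ω : ℝ) ≤ ∑ i, ((Finset.univ.filter (bad i)).card : ℝ) := by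
    norm_cast
    rw [← Finset.card_univ]
    refine (Finset.card_le_card fun ω _ => ?_).trans Finset.card_biUnion_le
    obtain ⟨i, hi⟩ := hcon ω
    exact Finset.mem_biUnion.mpr ⟨i, Finset.mem_univ _, by simpa using hi⟩
  have h2 : ∑ i, ((Finset.univ.filter (bad i)).card : ℝ) ≤
      Fintype.card ι * (β * Fintype.card Ω) := by
    rw [← nsmul_eq_mul]
    exact Finset.sum_le_card_nsmul _ _ _ fun i _ => h i
  nlinarith

theorem exists_isPseudorandom {n k d : ℕ} [NeZero d] (hkn : k ≤ n) {L η ε β : ℝ} (hL : 0 ≤ L)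
    (hη0 : 0 ≤ η) (hη1 : η ≤ 1) (hε : 0 ≤ ε)
    (h1 : Real.exp (-((2 ^ n / (2 ^ k * d)) * η ^ 2 / 4)) ≤ β)
    (h2 : Real.exp (1 / d * (2 * L) - ε * L) ≤ β)
    (h3 : Real.exp (-(ε * (2 ^ n / (2 ^ k * d)))) ≤ β) (hβ : 8 * 16 ^ n * β < 1) :
    ∃ D : BitStr n → BitStr k × Fin d, IsPseudorandom D L η ε := by
  classical
  have hd : (0 : ℝ) < d := by exact_mod_cast Nat.pos_of_ne_zero (NeZero.ne d)
  have hβ0 : 0 ≤ β := (Real.exp_pos _).le.trans h3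
  have hX : (Fintype.card (BitStr n) : ℝ) = 2 ^ n := by simp
  have hA : (Fintype.card (BitStr k × Fin d) : ℝ) = 2 ^ k * d := by simp
  set S : Finset (BitStr k × Fin d) := Finset.univ.filter fun a => a.2 = 0 with hSdef
  have hS : (S.card : ℝ) / Fintype.card (BitStr k × Fin d) = 1 / d := by
    have : S = Finset.univ ×ˢ {0} := by ext ⟨m, j⟩; simp [hSdef, eq_comm]
    rw [hA, this, Finset.card_product]
    simp
    field_simp
  have hmS : ∀ a, a ∈ S ↔ a.2 = 0 := by simp [hSdef]
  let bad₁ : (Fin n → Bool → Bool) × BitStr k → (BitStr n → BitStr k × Fin d) → Prop :=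
    fun p D => 2 ^ n / (2 ^ k * d) * η <
      |(((cube p.1).filter fun x => D x = (p.2, 0)).card : ℝ) - (cube p.1).card / (2 ^ k * d)|
  let bad₂ : (Fin n → Bool → Bool) → (BitStr n → BitStr k × Fin d) → Prop :=
    fun F D => L ≤ spread F ∧
      ε * 2 ^ n ≤ (Finset.univ.filter fun x => D (bitwise F x) ∈ S).card
  -- Fixing a coordinate where `F` changes the bit, and the old bit there, puts `x` in a half cube
  -- and its image outside it. The labels of the two points are then independent.
  let bad₃ : (Fin n → Bool → Bool) × BitStr k × Fin n × Bool →
      (BitStr n → BitStr k × Fin d) → Prop :=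
    fun p D => ((Finset.univ.filter fun x => D (bitwise p.1 x) ∈ S).card : ℝ) ≤ ε * 2 ^ n ∧
      3 * ε * (2 ^ n / (2 ^ k * d)) ≤ (Finset.univ.filter fun x => (x p.2.2.1 = p.2.2.2 ∧
        ¬ (bitwise p.1 x p.2.2.1 = p.2.2.2) ∧ D (bitwise p.1 x) ∈ S) ∧ D x = (p.2.1, 0)).card
  have hC : (0 : ℝ) ≤ Fintype.card (BitStr n → BitStr k × Fin d) := Nat.cast_nonneg _
  have hscale : ∀ {z : ℝ}, z ≤ β → Fintype.card (BitStr n → BitStr k × Fin d) * z ≤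
      2 * β * Fintype.card (BitStr n → BitStr k × Fin d) := by
    intro z hz
    nlinarith [mul_le_mul_of_nonneg_left hz hC, mul_nonneg hβ0 hC]
  have hb₁ : ∀ p, ((Finset.univ.filter (bad₁ p)).card : ℝ) ≤
      2 * β * Fintype.card (BitStr n → BitStr k × Fin d) := by
    intro p
    refine (card_deviation_le (cube p.1) (p.2, (0 : Fin d)) hη0 hη1 (bad₁ p) ?_).trans ?_
    · intro D hD
      rw [hX, hA]
      exact hD
    · rw [hX, hA, mul_assoc, mul_comm β]
      gcongr
  have hb₂ : ∀ F, ((Finset.univ.filter (bad₂ F)).card : ℝ) ≤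
      2 * β * Fintype.card (BitStr n → BitStr k × Fin d) := by
    intro F
    by_cases hF : L ≤ spread F
    · refine (card_preimage_large_le (bitwise F) S hL (ε := ε) ?_ (bad₂ F) ?_).trans ?_
      · intro y
        rw [hX]
        refine (mul_le_mul_of_nonneg_left hF (Nat.cast_nonneg _)).trans ?_
        exact_mod_cast card_fiber_mul_spread_le F y
      · intro D hD
        rw [hX]
        exact hD.2
      · rw [hS]
        exact hscale h2
    · have : (Finset.univ.filter (bad₂ F)) = ∅ :=
        Finset.filter_false_of_mem fun D _ hD => hF hD.1
      rw [this, Finset.card_empty, Nat.cast_zero]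
      exact mul_nonneg (by linarith) hC
  have hb₃ : ∀ p, ((Finset.univ.filter (bad₃ p)).card : ℝ) ≤
      2 * β * Fintype.card (BitStr n → BitStr k × Fin d) := by
    rintro ⟨F, m, i, v⟩
    -- The threshold `3 ε t`, with `t` the mean fibre size, exceeds the exponential-moment term `2 τ
    -- / |A| = 2 ε t` by `ε t`.
    refine (card_moved_large_le (bitwise F) (fun x => x i = v) S (m, (0 : Fin d))
      (τ := ε * 2 ^ n) (by positivity) (bad₃ (F, m, i, v)) (fun D hD => hD)).trans ?_
    rw [hA, show 2 * (ε * 2 ^ n) / (2 ^ k * d) - 3 * ε * (2 ^ n / (2 ^ k * d)) =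
      -(ε * (2 ^ n / (2 ^ k * d : ℝ))) by ring]
    exact hscale h3
  have hex : ∃ D, ∀ i, ¬ (Sum.elim bad₁ (Sum.elim bad₂ bad₃)) i D := by
    refine exists_forall_not_of_card_lt _ (β := 2 * β) ?_ ?_
    · rintro (p | F | p)
      · convert hb₁ p
        exact Iff.rfl
      · convert hb₂ F
        exact Iff.rfl
      · convert hb₃ p
        exact Iff.rfl
    · have hcard : (Fintype.card ((Fin n → Bool → Bool) × BitStr k ⊕ (Fin n → Bool → Bool) ⊕
          (Fin n → Bool → Bool) × BitStr k × Fin n × Bool) : ℝ) ≤ 4 * 16 ^ n := by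
        simp only [Fintype.card_sum, Fintype.card_prod, Fintype.card_fun, Fintype.card_bool,
          Fintype.card_fin, Nat.reducePow]
        norm_cast
        have e1 : 4 ^ n * 2 ^ k ≤ 8 ^ n := by
          rw [show (8 : ℕ) = 4 * 2 by norm_num, mul_pow]
          gcongr
          norm_num
        have e2 : 8 ^ n * n ≤ 16 ^ n := by
          rw [show (16 : ℕ) = 8 * 2 by norm_num, mul_pow]
          gcongr
          exact Nat.lt_two_pow_self.le
        have e3 : 8 ^ n ≤ 16 ^ n := by gcongr; norm_num
        have e4 : 4 ^ n ≤ 16 ^ n := by gcongr; norm_num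
        have e5 : 4 ^ n * (2 ^ k * (n * 2)) ≤ 2 * (8 ^ n * n) := by
          calc 4 ^ n * (2 ^ k * (n * 2)) = 2 * (4 ^ n * 2 ^ k * n) := by ring
            _ ≤ _ := by gcongr
        omega
      nlinarith
  obtain ⟨D, hD⟩ := hex
  have hD1 : ∀ p, ¬ bad₁ p D := fun p => hD (Sum.inl p)
  have hD2 : ∀ p, ¬ bad₂ p D := fun p => hD (Sum.inr (Sum.inl p))
  have hD3 : ∀ p, ¬ bad₃ p D := fun p => hD (Sum.inr (Sum.inr p))
  refine ⟨D, ⟨fun G m => not_lt.mp (hD1 (G, m)), fun F hF m => ?_⟩⟩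
  have hF2 : ((Finset.univ.filter fun x => D (bitwise F x) ∈ S).card : ℝ) ≤ ε * 2 ^ n := by
    by_contra hlt
    exact hD2 F ⟨hF, (not_le.mp hlt).le⟩
  have hF3 : ∀ q : Fin n × Bool, ((Finset.univ.filter fun x => (x q.1 = q.2 ∧
      ¬ (bitwise F x q.1 = q.2) ∧ D (bitwise F x) ∈ S) ∧ D x = (m, 0)).card : ℝ) ≤
      3 * ε * (2 ^ n / (2 ^ k * d)) := by
    intro q
    by_contra hlt
    exact hD3 (F, m, q.1, q.2) ⟨hF2, (not_le.mp hlt).le⟩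
  have hcov : ((Finset.univ.filter fun x => D x = (m, 0) ∧ bitwise F x ≠ x ∧
      (D (bitwise F x)).2 = 0).card : ℝ) ≤ ∑ q : Fin n × Bool,
      ((Finset.univ.filter fun x => (x q.1 = q.2 ∧
      ¬ (bitwise F x q.1 = q.2) ∧ D (bitwise F x) ∈ S) ∧ D x = (m, 0)).card : ℝ) := by
    norm_cast
    refine (Finset.card_le_card fun x hx => ?_).trans Finset.card_biUnion_le
    simp only [Finset.mem_filter, Finset.mem_univ, true_and] at hx
    obtain ⟨i, hi⟩ := Function.ne_iff.mp hx.2.1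
    exact Finset.mem_biUnion.mpr ⟨(i, x i), Finset.mem_univ _, by
      simpa [hmS] using ⟨⟨hi, hx.2.2⟩, hx.1⟩⟩
  refine hcov.trans ((Finset.sum_le_card_nsmul _ _ _ fun q _ => hF3 q).trans (le_of_eq ?_))
  simp only [Finset.card_univ, Fintype.card_prod, Fintype.card_fin, Fintype.card_bool,
    nsmul_eq_mul, Nat.cast_mul, Nat.cast_ofNat]
  ring

/-! ### Statistical distance -/

section StatDist

variable {Ω Ω' : Type*} [Fintype Ω]

theorem sum_apply_eq_one (p : PMF Ω) : ∑ x, p x = 1 := by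
  rw [← p.tsum_coe, tsum_fintype]

theorem sum_toReal_eq_one (p : PMF Ω) : ∑ x, (p x).toReal = 1 := by
  rw [← ENNReal.toReal_sum fun x _ => p.apply_ne_top x, sum_apply_eq_one, ENNReal.toReal_one]

theorem map_apply_toReal [DecidableEq Ω'] (p : PMF Ω) (g : Ω → Ω') (y : Ω') :
    ((p.map g) y).toReal = ∑ x, if g x = y then (p x).toReal else 0 := by
  rw [PMF.map_apply, tsum_fintype, ENNReal.toReal_sum]
  · refine Finset.sum_congr rfl fun x _ => ?_
    by_cases h : g x = y
    · simp [h]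
    · simp [h, Ne.symm h]
  · intro x _
    split_ifs
    · exact p.apply_ne_top x
    · simp

theorem bind_apply_toReal (p : PMF Ω) (f : Ω → PMF Ω') (y : Ω') :
    ((p.bind f) y).toReal = ∑ x, (p x).toReal * (f x y).toReal := by
  rw [PMF.bind_apply, tsum_fintype, ENNReal.toReal_sum]
  · simp [ENNReal.toReal_mul]
  · intro x _
    exact ENNReal.mul_ne_top (p.apply_ne_top x) ((f x).apply_ne_top y)

theorem statDist_triangle (p q r : PMF Ω) : statDist p r ≤ statDist p q + statDist q r := by
  unfold statDist
  rw [← mul_add, ← Finset.sum_add_distrib]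
  gcongr
  exact abs_sub_le _ _ _

theorem statDist_le_one (p q : PMF Ω) : statDist p q ≤ 1 := by
  have : ∑ x, |(p x).toReal - (q x).toReal| ≤ ∑ x, ((p x).toReal + (q x).toReal) := by
    refine Finset.sum_le_sum fun x _ => (abs_sub _ _).trans (le_of_eq ?_)
    simp
  rw [Finset.sum_add_distrib, sum_toReal_eq_one, sum_toReal_eq_one] at this
  unfold statDist
  linarith

theorem uniformOfFinset_map_toReal [DecidableEq Ω] [DecidableEq Ω'] (E : Finset Ω)
    (hE : E.Nonempty) (g : Ω → Ω') (y : Ω') :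
    (((PMF.uniformOfFinset E hE).map g) y).toReal = (E.filter fun x => g x = y).card / E.card := by
  rw [map_apply_toReal, Finset.card_filter, Nat.cast_sum, Finset.sum_div]
  rw [← Finset.sum_subset (Finset.subset_univ E)]
  · refine Finset.sum_congr rfl fun x hx => ?_
    simp [PMF.uniformOfFinset_apply, hx]
    split_ifs <;> simp
  · intro x _ hx
    simp [PMF.uniformOfFinset_apply, hx]

variable [Fintype Ω']

theorem statDist_map_le (p q : PMF Ω) (g : Ω → Ω') :
    statDist (p.map g) (q.map g) ≤ statDist p q := by
  classical
  unfold statDist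
  gcongr
  calc ∑ y, |((p.map g) y).toReal - ((q.map g) y).toReal|
      ≤ ∑ y, ∑ x, if g x = y then |(p x).toReal - (q x).toReal| else 0 := by
        refine Finset.sum_le_sum fun y _ => ?_
        rw [map_apply_toReal, map_apply_toReal, ← Finset.sum_sub_distrib]
        refine (Finset.abs_sum_le_sum_abs _ _).trans (Finset.sum_le_sum fun x _ => ?_)
        split_ifs <;> simp
    _ = ∑ x, |(p x).toReal - (q x).toReal| := by
        rw [Finset.sum_comm]; simp

/-- Coupling through a common sample: each sample on which `g` and `h` disagree contributes at most
twice its mass to the `ℓ¹` distance. -/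
theorem statDist_map_map_le (p : PMF Ω) (g h : Ω → Ω') [DecidablePred fun x => g x ≠ h x] :
    statDist (p.map g) (p.map h) ≤ ∑ x, if g x ≠ h x then (p x).toReal else 0 := by
  classical
  unfold statDist
  have : ∑ y, |((p.map g) y).toReal - ((p.map h) y).toReal|
      ≤ ∑ x, 2 * if g x ≠ h x then (p x).toReal else 0 := by
    calc ∑ y, |((p.map g) y).toReal - ((p.map h) y).toReal|
        ≤ ∑ y, ∑ x, ((if g x = y then (if g x ≠ h x then (p x).toReal else 0) else 0) +
            if h x = y then (if g x ≠ h x then (p x).toReal else 0) else 0) := by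
          refine Finset.sum_le_sum fun y _ => ?_
          rw [map_apply_toReal, map_apply_toReal, ← Finset.sum_sub_distrib]
          refine (Finset.abs_sum_le_sum_abs _ _).trans (Finset.sum_le_sum fun x _ => ?_)
          by_cases h0 : g x = h x
          · simp [h0]
          · rw [if_pos h0]
            have hp : 0 ≤ (p x).toReal := ENNReal.toReal_nonneg
            split_ifs <;> simp [hp]
      _ = _ := by
          rw [Finset.sum_comm]
          refine Finset.sum_congr rfl fun x _ => ?_
          rw [Finset.sum_add_distrib]
          simp only [Finset.sum_ite_eq, Finset.mem_univ, if_true]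
          ring
  rw [← Finset.mul_sum] at this
  linarith

theorem statDist_bind_le (p : PMF Ω) (f g : Ω → PMF Ω') {ε : ℝ}
    (h : ∀ x, statDist (f x) (g x) ≤ ε) : statDist (p.bind f) (p.bind g) ≤ ε := by
  calc statDist (p.bind f) (p.bind g)
      ≤ 1 / 2 * ∑ y, ∑ x, (p x).toReal * |(f x y).toReal - (g x y).toReal| := by
        unfold statDist
        gcongr with y
        rw [bind_apply_toReal, bind_apply_toReal, ← Finset.sum_sub_distrib]
        refine (Finset.abs_sum_le_sum_abs _ _).trans (Finset.sum_le_sum fun x _ => ?_)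
        rw [← mul_sub, abs_mul, abs_of_nonneg ENNReal.toReal_nonneg]
    _ = ∑ x, (p x).toReal * statDist (f x) (g x) := by
        rw [Finset.sum_comm, Finset.mul_sum]
        refine Finset.sum_congr rfl fun x _ => ?_
        rw [← Finset.mul_sum, statDist]
        ring
    _ ≤ ∑ x, (p x).toReal * ε := by
        gcongr with x
        exact h x
    _ = ε := by rw [← Finset.sum_mul, sum_toReal_eq_one, one_mul]

/-- The images of two uniform distributions under `g` are close if all fibres of `g` have nearly
the same weight in both. -/
theorem statDist_uniformOfFinset_map_le [DecidableEq Ω] [DecidableEq Ω'] (E E' : Finset Ω)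
    (hE : E.Nonempty) (hE' : E'.Nonempty) (g : Ω → Ω') {δ : ℝ}
    (h : ∀ y, |((E.filter fun x => g x = y).card / E.card : ℝ) -
      (E'.filter fun x => g x = y).card / E'.card| ≤ δ) :
    statDist ((PMF.uniformOfFinset E hE).map g) ((PMF.uniformOfFinset E' hE').map g) ≤
      1 / 2 * ((Finset.univ.image g).card * δ) := by
  unfold statDist
  gcongr
  simp only [uniformOfFinset_map_toReal]
  rw [← Finset.sum_subset (Finset.subset_univ (Finset.univ.image g)), ← nsmul_eq_mul]
  · exact Finset.sum_le_card_nsmul _ _ _ fun y _ => h y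
  · intro y _ hy
    have : ∀ x, g x ≠ y := by simpa using hy
    simp [this]

end StatDist

/-! ### The code given by a labelling -/

/-- The codewords of the message `m`. -/
def codewords {n k d : ℕ} [NeZero d] (D : BitStr n → BitStr k × Fin d) (m : BitStr k) :
    Finset (BitStr n) :=
  Finset.univ.filter fun x => D x = (m, 0)

/-- The coding scheme that encodes `m` as a uniformly random string labelled `(m, 0)`. -/
def labelScheme {n k d : ℕ} [NeZero d] (D : BitStr n → BitStr k × Fin d)
    (hD : ∀ m, (codewords D m).Nonempty) : CodingScheme k n where
  enc m := PMF.uniformOfFinset (codewords D m) (hD m)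
  dec x := if (D x).2 = 0 then some (D x).1 else none
  correct m := by
    rw [PMF.apply_eq_one_iff, PMF.support_map, PMF.support_uniformOfFinset]
    refine Set.eq_singleton_iff_nonempty_unique_mem.mpr ⟨(hD m).to_set.image _, ?_⟩
    rintro _ ⟨x, hx, rfl⟩
    have : D x = (m, 0) := by simpa [codewords] using hx
    simp [this]

/-! ### Equidistribution of codewords over subcubes -/

section Pseudorandom

variable {n k d : ℕ} [NeZero d] {D : BitStr n → BitStr k × Fin d} {L η ε : ℝ}

theorem IsPseudorandom.card_codewords (h : IsPseudorandom D L η ε) (m : BitStr k) :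
    |((codewords D m).card : ℝ) - 2 ^ n / (2 ^ k * d)| ≤ 2 ^ n / (2 ^ k * d) * η := by
  have := h.balanced (fun _ _ => true) m
  simpa [cube, codewords] using this

theorem IsPseudorandom.half_le_card_codewords (h : IsPseudorandom D L η ε) (hη : η ≤ 1 / 2)
    (m : BitStr k) : (2 ^ n / (2 ^ k * d) : ℝ) / 2 ≤ (codewords D m).card := by
  have h1 := (abs_le.mp (h.card_codewords m)).1
  have h2 : (0 : ℝ) ≤ 2 ^ n / (2 ^ k * d) := by positivity
  nlinarith

theorem density_pos (n k d : ℕ) [NeZero d] : (0 : ℝ) < 2 ^ n / (2 ^ k * d) := by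
  have hd : (0 : ℝ) < d := by exact_mod_cast Nat.pos_of_ne_zero (NeZero.ne d)
  positivity

theorem IsPseudorandom.codewords_nonempty (h : IsPseudorandom D L η ε) (hη : η ≤ 1 / 2)
    (m : BitStr k) : (codewords D m).Nonempty := by
  have h1 := h.half_le_card_codewords hη m
  have h2 := density_pos n k d
  rw [← Finset.card_pos, ← Nat.cast_pos (α := ℝ)]
  linarith

/-- Numerator and denominator each err by at most `t η`, with `t` the expected number of codewords.
The denominator is at least `t / 2`, whence `4 η`. -/
theorem IsPseudorandom.frequency (h : IsPseudorandom D L η ε) (hη : η ≤ 1 / 2)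
    (hη0 : 0 ≤ η) (G : Fin n → Bool → Bool) (m : BitStr k) :
    |(((codewords D m).filter (· ∈ cube G)).card / (codewords D m).card : ℝ) -
      (cube G).card / 2 ^ n| ≤ 4 * η := by
  have hd : (0 : ℝ) < d := by exact_mod_cast Nat.pos_of_ne_zero (NeZero.ne d)
  have h1 := h.half_le_card_codewords hη m
  have h2 := h.card_codewords m
  have h3 := h.balanced G m
  have ht := density_pos n k d
  have hfil : ((cube G).filter fun x => D x = (m, 0)) =
      (codewords D m).filter (· ∈ cube G) := by
    ext x; simp [codewords, and_comm]
  rw [hfil] at h3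
  set t : ℝ := 2 ^ n / (2 ^ k * d) with htdef
  set e : ℝ := ((codewords D m).card : ℝ)
  set q : ℝ := (((codewords D m).filter (· ∈ cube G)).card : ℝ)
  set ρ : ℝ := ((cube G).card : ℝ) / 2 ^ n with hρ
  have hρ0 : 0 ≤ ρ := by positivity
  have hρ1 : ρ ≤ 1 := by
    rw [hρ, div_le_one (by positivity)]
    have := Finset.card_le_univ (cube G)
    simp only [Fintype.card_fun, Fintype.card_bool, Fintype.card_fin] at this
    exact_mod_cast this
  have hQ : ((cube G).card : ℝ) / (2 ^ k * d) = ρ * t := by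
    rw [hρ, htdef]; field_simp
  rw [hQ] at h3
  have he : 0 < e := by linarith
  have hdiv : q / e - ρ = (q - ρ * e) / e := by field_simp
  rw [hdiv, abs_div, abs_of_pos he, div_le_iff₀ he]
  have h4 : |q - ρ * e| ≤ |q - ρ * t| + ρ * |e - t| := by
    rw [← abs_of_nonneg hρ0, ← abs_mul, abs_of_nonneg hρ0, mul_sub]
    have := abs_sub (q - ρ * t) (ρ * e - ρ * t)
    rwa [sub_sub_sub_cancel_right] at this
  have h5 : ρ * |e - t| ≤ t * η := by
    nlinarith [abs_nonneg (e - t)]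
  nlinarith

end Pseudorandom

theorem IsPseudorandom.exists_simulator {n k d : ℕ} [NeZero d]
    {D : BitStr n → BitStr k × Fin d} {L η ε : ℝ} (h : IsPseudorandom D L η ε) (hη : η ≤ 1 / 2)
    (hη0 : 0 ≤ η) (hε : 0 ≤ ε) (hL : 0 ≤ L) (F : Fin n → Bool → Bool) :
    ∃ P : PMF (Option (Option (BitStr k))), ∀ m,
      statDist (((labelScheme D (h.codewords_nonempty hη)).enc m).map
        ((labelScheme D (h.codewords_nonempty hη)).dec ∘ bitwise F)) (copy P m) ≤
        2 * (L * η) + 12 * n * ε + 4 * η := by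
  classical
  set C := labelScheme D (h.codewords_nonempty hη) with hC
  have hU : (Finset.univ : Finset (BitStr n)).Nonempty := Finset.univ_nonempty
  have hN : ((Finset.univ : Finset (BitStr n)).card : ℝ) = 2 ^ n := by simp
  have hLη : 0 ≤ L * η := mul_nonneg hL hη0
  have hnε : 0 ≤ n * ε := mul_nonneg (Nat.cast_nonneg n) hε
  by_cases hF : L ≤ spread F
  -- Large image: the simulator answers `same*` when a uniform string is fixed by `F`, and `⊥`
  -- otherwise.
  · refine ⟨(PMF.uniformOfFinset Finset.univ hU).map
      fun x => if bitwise F x = x then none else some none, fun m => ?_⟩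
    set g : BitStr n → Bool := fun x => decide (bitwise F x = x) with hg
    set out : Bool → Option (BitStr k) := fun b => if b then some m else none with hout
    have hcopy : copy ((PMF.uniformOfFinset Finset.univ hU).map
        fun x => if bitwise F x = x then none else some none) m =
        ((PMF.uniformOfFinset Finset.univ hU).map g).map out := by
      rw [copy, PMF.map_comp, PMF.map_comp]
      congr 1
      funext x
      by_cases hx : bitwise F x = x <;> simp [hg, hout, hx]
    rw [hcopy]
    refine (statDist_triangle _ (((C.enc m).map g).map out) _).trans ?_
    have h1 : statDist ((C.enc m).map (C.dec ∘ bitwise F)) (((C.enc m).map g).map out) ≤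
        12 * n * ε := by
      rw [PMF.map_comp]
      refine (statDist_map_map_le _ _ _).trans ?_
      have hcard := h.half_le_card_codewords hη m
      have ht := density_pos n k d
      have hs := h.sparse F hF m
      have hpos : (0 : ℝ) < (codewords D m).card := by linarith
      have hle : ∀ x, (if (C.dec ∘ bitwise F) x ≠ (out ∘ g) x then ((C.enc m) x).toReal else 0) ≤
          if D x = (m, 0) ∧ bitwise F x ≠ x ∧ (D (bitwise F x)).2 = 0 then
            ((codewords D m).card : ℝ)⁻¹ else 0 := by
        intro x
        have henc : (C.enc m x).toReal = if D x = (m, 0) then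
            ((codewords D m).card : ℝ)⁻¹ else 0 := by
          simp only [hC, labelScheme, PMF.uniformOfFinset_apply, codewords, Finset.mem_filter,
            Finset.mem_univ, true_and]
          split_ifs <;> simp
        rw [henc]
        by_cases hx : D x = (m, 0)
        · by_cases hfx : bitwise F x = x
          · simp [hC, labelScheme, hout, hg, hx, hfx]
          · by_cases h2 : (D (bitwise F x)).2 = 0
            · simp [hC, labelScheme, hout, hg, hx, hfx, h2]
            · simp [hC, labelScheme, hout, hg, hfx, h2]
        · simp [hx]
      refine (Finset.sum_le_sum fun x _ => hle x).trans ?_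
      rw [← Finset.sum_filter, Finset.sum_const, nsmul_eq_mul, ← div_eq_mul_inv,
        div_le_iff₀ hpos]
      refine hs.trans ?_
      have := mul_le_mul_of_nonneg_left hcard (by positivity : 0 ≤ 12 * (n * ε))
      linarith
    have h2 : statDist (((C.enc m).map g).map out)
        (((PMF.uniformOfFinset Finset.univ hU).map g).map out) ≤ 4 * η := by
      refine (statDist_map_le _ _ _).trans ((statDist_uniformOfFinset_map_le (codewords D m)
        Finset.univ (h.codewords_nonempty hη m) hU g (δ := 4 * η) ?_).trans ?_)
      · have htrue : |(((codewords D m).filter fun x => g x = true).card /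
            (codewords D m).card : ℝ) - (Finset.univ.filter fun x => g x = true).card /
            (Finset.univ : Finset (BitStr n)).card| ≤ 4 * η := by
          -- Being fixed by a bitwise function is a coordinatewise condition, hence a subcube.
          have := h.frequency hη hη0 (fun t b => F t b == b) m
          have hfix : ∀ x, x ∈ cube (fun t b => F t b == b) ↔ g x = true := by
            intro x; simp [cube, hg, bitwise, funext_iff]
          have hcube : cube (fun t b => F t b == b) = Finset.univ.filter fun x => g x = true := by
            ext x; simp [hfix]
          simp only [hfix] at this
          rwa [hcube, ← hN] at this
        have hcompl : ∀ E : Finset (BitStr n), E.Nonempty →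
            ((E.filter fun x => g x = false).card / E.card : ℝ) =
            1 - (E.filter fun x => g x = true).card / E.card := by
          intro E hE
          have hE0 : (E.card : ℝ) ≠ 0 := by
            exact_mod_cast (Finset.card_pos.mpr hE).ne'
          have := Finset.card_filter_add_card_filter_not (s := E) (fun x => g x = true)
          simp only [Bool.not_eq_true] at this
          have h' : ((E.filter fun x => g x = true).card : ℝ) +
            (E.filter fun x => g x = false).card = E.card := by exact_mod_cast this
          field_simp
          linarith
        rintro (_ | _)
        · rw [hcompl _ (h.codewords_nonempty hη m), hcompl _ hU, sub_sub_sub_cancel_left,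
            abs_sub_comm]
          exact htrue
        · exact htrue
      · have : ((Finset.univ.image g).card : ℝ) ≤ 2 := by
          exact_mod_cast (Finset.card_le_univ _).trans (by simp)
        nlinarith
    linarith
  -- Small image: the simulator tampers with a uniform string and decodes. Fewer than `L` fibres,
  -- each off by `4 η`, cost `2 L η`.
  · refine ⟨(PMF.uniformOfFinset Finset.univ hU).map fun x => some (C.dec (bitwise F x)),
      fun m => ?_⟩
    have hcopy : copy ((PMF.uniformOfFinset Finset.univ hU).map
        fun x => some (C.dec (bitwise F x))) m =
        ((PMF.uniformOfFinset Finset.univ hU).map (bitwise F)).map C.dec := by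
      rw [copy, PMF.map_comp, PMF.map_comp]
      rfl
    rw [hcopy, ← PMF.map_comp]
    refine (statDist_map_le _ _ _).trans ((statDist_uniformOfFinset_map_le (codewords D m)
      Finset.univ (h.codewords_nonempty hη m) hU (bitwise F) (δ := 4 * η) ?_).trans ?_)
    · intro y
      have := h.frequency hη hη0 (fun t b => F t b == y t) m
      have hfib : ∀ x, x ∈ cube (fun t b => F t b == y t) ↔ bitwise F x = y := by
        intro x; simp [cube, bitwise, funext_iff]
      have hcube : cube (fun t b => F t b == y t) =
          Finset.univ.filter fun x => bitwise F x = y := by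
        ext x; simp [hfib]
      simp only [hfib] at this
      rwa [hcube, ← hN] at this
    · have h1 : ((Finset.univ.image (bitwise F)).card : ℝ) ≤ L :=
        le_trans (by exact_mod_cast card_image_bitwise_le F) (not_le.mp hF).le
      have := mul_le_mul_of_nonneg_right h1 hη0
      linarith

/-! ### Binary channels as mixtures of bitwise tampering functions -/

theorem sum_prod_apply_eq_one {ι : Type*} [Fintype ι] [DecidableEq ι] (p : ι → PMF Bool) :
    ∑ g : ι → Bool, ∏ i, p i (g i) = 1 := by
  rw [← Fintype.prod_sum fun i b => p i b]
  exact Finset.prod_eq_one fun i _ => sum_apply_eq_one (p i)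

/-- The random bitwise tampering function that evaluates the channel independently on every
position and on both possible input bits. -/
def channelMixture {S : Type*} (W : AVC Bool S Bool) {n : ℕ} (s : Fin n → S) :
    PMF (Fin n → Bool → Bool) :=
  PMF.ofFintype (fun F => ∏ t, ∏ b, W b (s t) (F t b)) (by
    rw [← Fintype.prod_sum fun t (g : Bool → Bool) => ∏ b, W b (s t) (g b)]
    exact Finset.prod_eq_one fun t _ => sum_prod_apply_eq_one fun b => W b (s t))

/-- Only the value of `F t` at `x t` is observed; the factor for the other input bit sums to 1. -/
theorem seqOutput_eq_map_channelMixture {S : Type*} (W : AVC Bool S Bool) {n : ℕ}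
    (s : Fin n → S) (x : BitStr n) :
    W.seqOutput s x = (channelMixture W s).map fun F => bitwise F x := by
  ext y
  rw [PMF.map_apply, tsum_fintype, AVC.seqOutput, PMF.ofFintype_apply]
  have hterm : ∀ F : Fin n → Bool → Bool,
      (if y = bitwise F x then channelMixture W s F else 0) =
        ∏ t, if F t (x t) = y t then ∏ b, W b (s t) (F t b) else 0 := by
    intro F
    by_cases hy : y = bitwise F x
    · subst hy
      simp [channelMixture, bitwise]
    · rw [if_neg hy]
      obtain ⟨t, ht⟩ := Function.ne_iff.mp hy
      exact (Finset.prod_eq_zero (Finset.mem_univ t) (if_neg (Ne.symm ht))).symm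
  trans ∑ F : Fin n → Bool → Bool,
    ∏ t, if F t (x t) = y t then ∏ b, W b (s t) (F t b) else 0
  swap
  · refine Finset.sum_congr rfl fun F _ => ?_
    rw [← hterm F]
    split_ifs <;> rfl
  rw [← Fintype.prod_sum fun t (g : Bool → Bool) =>
    if g (x t) = y t then ∏ b, W b (s t) (g b) else 0]
  refine Finset.prod_congr rfl fun t _ => ?_
  -- Moving the constraint into the factor `b = x t` lets the sum over `g` factor over input bits.
  have hterm' : ∀ g : Bool → Bool, (if g (x t) = y t then ∏ b, W b (s t) (g b) else 0) =
      ∏ b, if b = x t then (if g b = y t then W b (s t) (g b) else 0) else W b (s t) (g b) := by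
    intro g
    by_cases hg : g (x t) = y t
    · rw [if_pos hg]
      refine Finset.prod_congr rfl fun b _ => ?_
      split_ifs with h1 h2
      · rfl
      · exact absurd (h1 ▸ hg) h2
      · rfl
    · rw [if_neg hg]
      exact (Finset.prod_eq_zero (Finset.mem_univ (x t)) (by simp [hg])).symm
  simp only [hterm']
  rw [← Fintype.prod_sum fun b c =>
    if b = x t then (if c = y t then W b (s t) c else 0) else W b (s t) c]
  rw [Finset.prod_eq_single (x t)]
  · simp
  · intro b _ hb
    simp only [hb, if_false]
    exact sum_apply_eq_one _
  · simp

/-- The law of `F` depends on `s` alone, so mixing the simulators `P F` with the same law gives one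
simulator valid for all messages. -/
theorem isNonMalleable_of_bitwise {S : Type*} {k n : ℕ} (C : CodingScheme k n)
    (W : AVC Bool S Bool) {δ : ℝ}
    (h : ∀ F : Fin n → Bool → Bool, ∃ P : PMF (Option (Option (BitStr k))), ∀ m,
      statDist ((C.enc m).map (C.dec ∘ bitwise F)) (copy P m) ≤ δ) :
    IsNonMalleable C W δ := by
  choose P hP using h
  intro s
  refine ⟨(channelMixture W s).bind P, fun m => ?_⟩
  have h1 : tamper C W s m =
      (channelMixture W s).bind fun F => (C.enc m).map (C.dec ∘ bitwise F) := by
    simp only [tamper, seqOutput_eq_map_channelMixture, PMF.map_bind, PMF.map_comp]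
    simp only [PMF.map]
    rw [PMF.bind_comm]
    rfl
  have h2 : copy ((channelMixture W s).bind P) m =
      (channelMixture W s).bind fun F => copy (P F) m := by
    simp only [copy, PMF.map_bind]
  rw [h1, h2]
  exact statDist_bind_le _ _ _ fun F => hP F m

/-! ### Choice of parameters -/

theorem twelve_mul_sq_lt_two_pow {u : ℕ} (hu : 12 ≤ u) : 12 * (u + 1) ^ 2 < 2 ^ u := by
  induction u, hu using Nat.le_induction with
  | base => norm_num
  | succ v hv ih =>
    rw [pow_succ 2 v]
    nlinarith

theorem eight_mul_sixteen_pow_mul_exp_lt_one {n : ℕ} (hn : 144 ≤ n) :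
    8 * 16 ^ n * Real.exp (-(2 ^ Nat.sqrt n / 4)) < 1 := by
  have hu : 12 ≤ Nat.sqrt n := Nat.le_sqrt.mpr (by omega)
  have h1 : 12 * (n + 1) < 2 ^ Nat.sqrt n := by
    refine lt_of_le_of_lt ?_ (twelve_mul_sq_lt_two_pow hu)
    have := Nat.lt_succ_sqrt n
    simp only [Nat.succ_eq_add_one] at this
    nlinarith
  have h2 : (12 * (n + 1) : ℝ) < 2 ^ Nat.sqrt n := by exact_mod_cast h1
  have he : (16 : ℝ) ≤ Real.exp 3 := by
    have := Real.exp_one_gt_d9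
    rw [show (3 : ℝ) = 1 + 1 + 1 by norm_num, Real.exp_add, Real.exp_add]
    have h3 : (2.7 : ℝ) ≤ Real.exp 1 := by linarith
    have h4 : (2.7 : ℝ) * 2.7 ≤ Real.exp 1 * Real.exp 1 := by gcongr
    have h5 : (2.7 : ℝ) * 2.7 * 2.7 ≤ Real.exp 1 * Real.exp 1 * Real.exp 1 := by gcongr
    linarith
  calc 8 * 16 ^ n * Real.exp (-(2 ^ Nat.sqrt n / 4))
      ≤ Real.exp 3 * Real.exp 3 ^ n * Real.exp (-(2 ^ Nat.sqrt n / 4)) := by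
        gcongr; linarith
    _ = Real.exp (3 + n * 3 + -(2 ^ Nat.sqrt n / 4)) := by
        rw [← Real.exp_nat_mul, ← Real.exp_add, ← Real.exp_add]
    _ < 1 := by
        rw [Real.exp_lt_one_iff]
        linarith

theorem exists_nonMalleable_scheme {S : Type*} (W : AVC Bool S Bool) {n : ℕ} (hn : 144 ≤ n) :
    ∃ C : CodingScheme (n - 11 * Nat.sqrt n) n,
      IsNonMalleable C W ((12 * n + 6) / 2 ^ Nat.sqrt n) := by
  have hβ := eight_mul_sixteen_pow_mul_exp_lt_one hn
  have hu : 12 ≤ Nat.sqrt n := Nat.le_sqrt.mpr (by omega)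
  have hun : 11 * Nat.sqrt n ≤ n := by nlinarith [Nat.sqrt_le n]
  generalize Nat.sqrt n = u at hβ hu hun ⊢
  set k := n - 11 * u with hk
  set z : ℝ := 2 ^ u with hz
  have hz4 : 4 ≤ z := by
    calc (4 : ℝ) = 2 ^ 2 := by norm_num
      _ ≤ 2 ^ u := pow_le_pow_right₀ (by norm_num) (by omega)
  have hz0 : 0 < z := by linarith
  have hd : (((2 ^ (2 * u) : ℕ)) : ℝ) = z ^ 2 := by
    push_cast; rw [hz, ← pow_mul, mul_comm]
  have ht : (2 ^ n / (2 ^ k * (2 ^ (2 * u) : ℕ)) : ℝ) = z ^ 9 := by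
    rw [hd, div_eq_iff (by positivity), hz, ← pow_mul, ← pow_mul, ← pow_add, ← pow_add]
    congr 1
    omega
  have : NeZero (2 ^ (2 * u)) := ⟨by positivity⟩
  have hη1 : (1 / z ^ 4 : ℝ) ≤ 1 / 4 := by
    gcongr
    exact hz4.trans (le_self_pow₀ (by linarith) (by norm_num))
  -- With `d = z ^ 2` and mean fibre size `t = z ^ 9`, so `11 = 9 + 2`, the choices give `t η ^ 2 =
  -- z`, `ε L = z ^ 2` against `2 L / d = 2 z`, and `ε t = z ^ 8`. All three failure bounds are thus
  -- at most `exp (-z / 4)`, while `L η = ε = 1 / z` stays negligible.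
  obtain ⟨D, hD⟩ := exists_isPseudorandom (n := n) (k := k) (d := 2 ^ (2 * u)) (by omega)
    (L := z ^ 3) (η := 1 / z ^ 4) (ε := 1 / z) (β := Real.exp (-(z / 4)))
    (by positivity) (by positivity) (by linarith) (by positivity)
    (by
      rw [ht, Real.exp_le_exp]
      apply le_of_eq
      field_simp)
    (by
      rw [hd, Real.exp_le_exp]
      have e : 1 / z ^ 2 * (2 * z ^ 3) - 1 / z * z ^ 3 = 2 * z - z ^ 2 := by field_simp
      rw [e]
      nlinarith)
    (by
      rw [ht, Real.exp_le_exp]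
      have e : 1 / z * z ^ 9 = z ^ 8 := by field_simp
      rw [e]
      have := le_self_pow₀ (by linarith : 1 ≤ z) (by norm_num : (8 : ℕ) ≠ 0)
      linarith)
    hβ
  have hη2 : (1 / z ^ 4 : ℝ) ≤ 1 / 2 := by linarith
  refine ⟨labelScheme D (hD.codewords_nonempty hη2), isNonMalleable_of_bitwise _ W fun F => ?_⟩
  obtain ⟨P, hP⟩ := hD.exists_simulator hη2 (by positivity) (by positivity) (by positivity) F
  refine ⟨P, fun m => (hP m).trans ?_⟩
  have e1 : z ^ 3 * (1 / z ^ 4) = 1 / z := by field_simp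
  have e2 : 1 / z ^ 4 ≤ 1 / z := by
    gcongr
    exact le_self_pow₀ (by linarith) (by norm_num)
  have e3 : (12 * n + 6) / z = 12 * n * (1 / z) + 6 * (1 / z) := by ring
  rw [e1, e3]
  linarith

/-- The scheme with a single message. -/
def trivialScheme (n : ℕ) : CodingScheme 0 n where
  enc _ := PMF.pure fun _ => false
  dec _ := some default
  correct m := by
    rw [Subsingleton.elim m default, PMF.pure_map, PMF.pure_apply_self]

theorem trivialScheme_isNonMalleable {S : Type*} (W : AVC Bool S Bool) (n : ℕ) :
    IsNonMalleable (trivialScheme n) W 1 :=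
  fun _ => ⟨PMF.pure none, fun _ => statDist_le_one _ _⟩

/-! ### Asymptotics of error and rate -/

theorem tendsto_nat_sqrt_atTop : Tendsto Nat.sqrt atTop atTop :=
  tendsto_atTop_atTop.mpr fun b => ⟨b * b, fun _ h => Nat.le_sqrt.mpr h⟩

theorem superpolynomialDecay_error {ε : ℕ → ℝ}
    (hε : ∀ n, 144 ≤ n → ε n = (12 * n + 6) / 2 ^ Nat.sqrt n) :
    Asymptotics.SuperpolynomialDecay atTop (fun n : ℕ => (n : ℝ)) ε := by
  intro c
  -- Bounding `n` by `(√n + 1) ^ 2` in `n ^ c` and in the error gives the exponent `2 * c + 2`.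
  -- Passing to `2 ^ (√n + 1)` doubles 18 to 36.
  have h1 := ((tendsto_pow_const_div_const_pow_of_one_lt (2 * c + 2)
    (by norm_num : (1 : ℝ) < 2)).comp
      ((tendsto_add_atTop_nat 1).comp tendsto_nat_sqrt_atTop)).const_mul 36
  rw [mul_zero] at h1
  refine squeeze_zero' ?_ ?_ h1
  · filter_upwards [eventually_ge_atTop 144] with n hn
    rw [hε n hn]
    positivity
  · filter_upwards [eventually_ge_atTop 144] with n hn
    rw [hε n hn]
    have hn2 : (n : ℝ) ≤ (Nat.sqrt n + 1) ^ 2 := by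
      have := (Nat.lt_succ_sqrt n).le
      rw [← pow_two] at this
      exact_mod_cast this
    have h6 : (12 * n + 6 : ℝ) ≤ 18 * (Nat.sqrt n + 1) ^ 2 := by
      have : (0 : ℝ) ≤ Nat.sqrt n := Nat.cast_nonneg _
      nlinarith
    simp only [Function.comp_apply, Nat.cast_add, Nat.cast_one]
    calc (n : ℝ) ^ c * ((12 * n + 6) / 2 ^ Nat.sqrt n)
        ≤ ((Nat.sqrt n + 1) ^ 2) ^ c * (18 * (Nat.sqrt n + 1) ^ 2 / 2 ^ Nat.sqrt n) := by gcongr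
      _ = 36 * ((Nat.sqrt n + 1) ^ (2 * c + 2) / 2 ^ (Nat.sqrt n + 1)) := by
          rw [pow_add, pow_mul, pow_succ (2 : ℝ)]
          ring

theorem tendsto_rate_one {k : ℕ → ℕ} (hk : ∀ n, 144 ≤ n → k n = n - 11 * Nat.sqrt n) :
    Tendsto (fun n : ℕ => (k n : ℝ) / (n : ℝ)) atTop (𝓝 1) := by
  have h1 : Tendsto (fun n => (11 : ℝ) / (Nat.sqrt n : ℝ)) atTop (𝓝 0) :=
    (tendsto_const_div_atTop_nhds_zero_nat 11).comp tendsto_nat_sqrt_atTop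
  have h2 : Tendsto (fun n => 1 - (11 : ℝ) / (Nat.sqrt n : ℝ)) atTop (𝓝 1) := by
    simpa using h1.const_sub 1
  refine tendsto_of_tendsto_of_tendsto_of_le_of_le' h2 tendsto_const_nhds ?_ ?_
  · filter_upwards [eventually_ge_atTop 144] with n hn
    have hu : 12 ≤ Nat.sqrt n := Nat.le_sqrt.mpr (by omega)
    have hsq := Nat.sqrt_le n
    have hun : 11 * Nat.sqrt n ≤ n := by nlinarith
    rw [hk n hn, Nat.cast_sub hun]
    have hu' : (0 : ℝ) < Nat.sqrt n := by exact_mod_cast (by omega : 0 < Nat.sqrt n)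
    have hn' : (0 : ℝ) < n := by exact_mod_cast (by omega : 0 < n)
    have hsq' : (Nat.sqrt n * Nat.sqrt n : ℝ) ≤ n := by exact_mod_cast hsq
    rw [sub_div, div_self hn'.ne']
    push_cast
    gcongr 1 - ?_
    rw [div_le_div_iff₀ hn' hu']
    linarith
  · filter_upwards [eventually_ge_atTop 144] with n hn
    rw [hk n hn, div_le_one (by exact_mod_cast (by omega : 0 < n))]
    exact_mod_cast Nat.sub_le _ _

end NonMalleableAVC

end

/-! ### Assembly, with the one-message scheme at block lengths below 144 -/

theorem mainTheorem2 {S : Type*} (W : NonMalleableAVC.AVC Bool S Bool) :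
    ∃ (k : ℕ → ℕ) (ε : ℕ → ℝ) (C : ∀ n : ℕ, NonMalleableAVC.CodingScheme (k n) n),
      (∀ n : ℕ, NonMalleableAVC.IsNonMalleable (C n) W (ε n)) ∧
      Asymptotics.SuperpolynomialDecay atTop (fun n : ℕ => (n : ℝ)) ε ∧
      Tendsto (fun n : ℕ => (k n : ℝ) / (n : ℝ)) atTop (𝓝 1) := by
  have key : ∀ n : ℕ, ∃ (k : ℕ) (ε : ℝ) (C : NonMalleableAVC.CodingScheme k n),
      NonMalleableAVC.IsNonMalleable C W ε ∧ (144 ≤ n → k = n - 11 * Nat.sqrt n) ∧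
        (144 ≤ n → ε = (12 * n + 6) / 2 ^ Nat.sqrt n) := by
    intro n
    by_cases hn : 144 ≤ n
    · obtain ⟨C, hC⟩ := NonMalleableAVC.exists_nonMalleable_scheme W hn
      exact ⟨_, _, C, hC, fun _ => rfl, fun _ => rfl⟩
    · exact ⟨0, 1, NonMalleableAVC.trivialScheme n,
        NonMalleableAVC.trivialScheme_isNonMalleable W n, fun h => absurd h hn,
        fun h => absurd h hn⟩
  choose k ε C hC hk hε using key
  exact ⟨k, ε, C, hC, NonMalleableAVC.superpolynomialDecay_error hε,
    NonMalleableAVC.tendsto_rate_one hk⟩
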